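/- Let $0\le\alpha<2$. For a square $J\subset\mathbb{R}^2$ with centre $c_J$ and side length $|J|^{1/2}$, and for positive Borel measures $\mu,\omega$ on $\mathbb{R}^2$ with $0<|J|_\omega<\infty$, put $$\mathsf{E}(J,\omega)^2=\frac{1}{|J|_\omega^2}\int_J\int_J\left|\frac{x-z}{|J|^{1/2}}\right|^2d\omega(x)\,d\omega(z),\qquad \mathrm{P}^\alpha(J,\mu)=\int_{\mathbb{R}^2}\frac{|J|^{1/2}}{\left(|J|^{1/2}+|y-c_J|\right)^{3-\alpha}}\,d\mu(y).$$ For a finite family $(\Omega_i)$ of functions on the unit circle let $\mathbf{T}^\alpha\mu=(T_i^\alpha\mu)_i$ with $T_i^\alpha\mu(x)=\int \Omega_i\!\left(\frac{x-y}{|x-y|}\right)|x-y|^{\alpha-2}\,d\mu(y)$. The strong reversal of energy inequality is $$\mathsf{E}(J,\omega)^2\,\mathrm{P}^\alpha(J,\mu)^2\le C_0\,\frac{1}{|J|_\omega^2}\int_J\int_J\left|\mathbf{T}^\alpha\mu(x)-\mathbf{T}^\alpha\mu(z)\right|^2d\omega(x)\,d\omega(z).\tag{1}$$ We say that (1) fails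 for $\mathbf{T}^\alpha$, $C_0$, $J$ and $\mu$ if there is a locally finite positive Borel measure $\omega$ on $\mathbb{R}^2$ with $|J|_\omega>0$ for which (1) does not hold. Let $\mathbf{R}^\alpha$ be the vector of $\alpha$-fractional Riesz transforms, with $\Omega_\ell(w/|w|)=w_\ell/|w|$, $\ell=1,2$, and for $M\ge1$ let $\mathbf{T}_M^\alpha$ be the vector whose angular parts are $\cos k\theta,\ \sin k\theta$, $1\le k\le M$, where $\theta$ is the angular coordinate of $w$. There are finite positive Borel measures $\nu_\gamma$ ($\gamma\in\mathbb{R}$) on $\mathbb{R}^2$, depending only on $\alpha$ and $\gamma$, with the following property. For every $C_0>0$ there is $\gamma_0>2$ such that for all $\gamma\ge\gamma_0$ and every square $J$ in the plane, the image $\mu$ of $\nu_\gamma$ under a similarity carrying the unit square $[-\frac12,\frac12]^2$ onto $J$ and its centre to $c_J$ has support disjoint from the dilate $\gamma J$, inequality (1) fails for $\mathbf{R}^\alpha$, $C_0$, $J$ and $\mu$, and moreover, for the same $\mu$ and for every $M\ge1$, inequality (1) fails for $\mathbf{T}_M^\alpha$, $C_0$, $J$ and $\mu$. -/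

import Mathlib

open MeasureTheory

noncomputable section

/-- The Euclidean plane. -/
abbrev Plane : Type := EuclideanSpace ℝ (Fin 2)

/-- A (closed, nondegenerate) square in the plane, in arbitrary position: centre, side length, and
an orthonormal frame giving the directions of its sides (the identity frame gives the squares with
sides parallel to the coordinate axes). -/
structure PlaneSquare where
  center : Plane
  side : ℝ
  side_pos : 0 < side
  frame : Plane ≃ₗᵢ[ℝ] Plane

namespace PlaneSquare

/-- The similarity that carries the unit square `[-1/2, 1/2]²` onto `J`. -/
def place (J : PlaneSquare) (u : Plane) : Plane := J.center + J.side • J.frame u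

/-- The dilate `γJ`: the square with the centre and the directions of `J` and side length
`γ` times that of `J`. -/
def dilate (J : PlaneSquare) (γ : ℝ) : Set Plane :=
  J.place '' {u : Plane | ∀ i, |u i| ≤ γ / 2}

/-- The points of the square `J` itself. -/
def carrier (J : PlaneSquare) : Set Plane := J.dilate 1

theorem measurable_place (J : PlaneSquare) : Measurable J.place := by
  have h : Continuous J.place :=
    continuous_const.add (J.frame.continuous.const_smul J.side)
  exact h.measurable

/-- The image of a measure under the similarity that carries the unit square onto `J`. -/
def transplant (J : PlaneSquare) (ν : Measure Plane) : Measure Plane := ν.map J.place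

end PlaneSquare

/-- The energy `E(J, ω)`: `E(J, ω)² = |J|_ω⁻² ∫_J ∫_J |(x - z) / |J|^{1/2}|² dω(x) dω(z)`;
note that `|J|^{1/2}` is the side length. -/
def energy (J : PlaneSquare) (ω : Measure Plane) : ℝ :=
  Real.sqrt (⨍ z in J.carrier, (⨍ x in J.carrier, (‖x - z‖ / J.side) ^ 2 ∂ω) ∂ω)

/-- The `α`-fractional Poisson integral in the plane,
`P^α(J, μ) = ∫ |J|^{1/2} / (|J|^{1/2} + |y - c_J|)^{3 - α} dμ(y)`. -/
def poisson (α : ℝ) (J : PlaneSquare) (μ : Measure Plane) : ℝ :=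
  ∫ y, J.side / (J.side + ‖y - J.center‖) ^ (3 - α) ∂μ

/-- The convolution kernel `K(w) = Ω(w / |w|) / |w|^{2 - α}` with angular part `Ω`. -/
def convKernel (α : ℝ) (Ω : Plane → ℝ) (w : Plane) : ℝ :=
  Ω (‖w‖⁻¹ • w) / ‖w‖ ^ (2 - α)

/-- The vector `T^α μ(x) = (∫ K_i(x - y) dμ(y))_i` of `α`-fractional transforms with angular parts
`Ω i`. It is only used at points at positive distance from the support of a finite measure, where
the integrals converge absolutely. -/
def vecTransform {ι : Type} [Fintype ι] (α : ℝ) (Ω : ι → Plane → ℝ) (μ : Measure Plane)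
    (x : Plane) : EuclideanSpace ℝ ι :=
  WithLp.toLp 2 fun i => ∫ y, convKernel α (Ω i) (x - y) ∂μ

/-- Angular parts of the two Riesz transforms: `Ω_ℓ(w / |w|) = w_ℓ / |w|`. -/
def rieszAngular (l : Fin 2) (u : Plane) : ℝ := u l

/-- The usual angular coordinate of a point of the plane. -/
def angle (u : Plane) : ℝ := Complex.arg ⟨u 0, u 1⟩

/-- The angular parts `cos kθ, sin kθ`, `1 ≤ k ≤ M`, of the vector `T_M^α`. -/
def trigAngular (M : ℕ) : Fin M ⊕ Fin M → Plane → ℝ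
  | Sum.inl j, u => Real.cos (((j : ℕ) + 1 : ℕ) * angle u)
  | Sum.inr j, u => Real.sin (((j : ℕ) + 1 : ℕ) * angle u)

/-- The strong reversal of energy inequality
`E(J, ω)² P^α(J, μ)² ≤ C₀ 𝔼_J^{ω(x)} 𝔼_J^{ω(z)} |T^α μ(x) - T^α μ(z)|²`
for the vector of transforms with angular parts `Ω i`. -/
def StrongReversal {ι : Type} [Fintype ι] (α : ℝ) (Ω : ι → Plane → ℝ) (C₀ : ℝ)
    (J : PlaneSquare) (ω μ : Measure Plane) : Prop :=
  energy J ω ^ 2 * poisson α J μ ^ 2 ≤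
    C₀ * ⨍ x in J.carrier, (⨍ z in J.carrier,
      ‖vecTransform α Ω μ x - vecTransform α Ω μ z‖ ^ 2 ∂ω) ∂ω

/-- The inequality fails for `μ`: there is a locally finite positive Borel measure `ω` charging `J`
for which it does not hold. -/
def ReversalFails {ι : Type} [Fintype ι] (α : ℝ) (Ω : ι → Plane → ℝ) (C₀ : ℝ)
    (J : PlaneSquare) (μ : Measure Plane) : Prop :=
  ∃ ω : Measure Plane, IsLocallyFiniteMeasure ω ∧ 0 < ω J.carrier ∧
    ¬ StrongReversal α Ω C₀ J ω μ

end

open Filter Topology Set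

/-! The measure is spread over a half circle with a weight for which every admissible transform has
vanishing horizontal derivative at the centre. If `κ` is homogeneous of degree `α - 2`, its
horizontal derivative has degree `α - 3`, so on projecting the half circle centrally to the line at
height one, the weight `(1 + s²)^(-(3 - α)/2)` exactly cancels the change of radius. What remains is
the integral of a derivative along the whole line, which is zero because `κ` decays at infinity
(`integral_fderiv_linePoint`, `integral_fderiv_circlePoint`). Only homogeneity and smoothness off
the origin enter, so a single measure serves all the kernels.

Now let `ω` be two unit masses, at the centre and at horizontal distance `t` from it in the
coordinates of the unit square. The left side of the inequality is a fixed positive multiple of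
`t²`, while the right side is `o(t²)`; a small `t` defeats any `C₀`
(`reversalFails_halfCircleMeasure`). -/

/-- A real kernel in the plane that is `C¹` off the origin and positively homogeneous of
degree `α - 2`. -/
structure IsHomogeneousKernel (α : ℝ) (κ : Plane → ℝ) : Prop where
  contDiffOn : ContDiffOn ℝ 1 κ {0}ᶜ
  map_smul : ∀ c : ℝ, 0 < c → ∀ w : Plane, w ≠ 0 → κ (c • w) = c ^ (α - 2) * κ w

/-! ### The half circle and its weight -/

/-- The first vector of the standard basis. -/
noncomputable def horizontal : Plane := !₂[1, 0]

/-- The parametrization of the line at height one. -/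
noncomputable def linePoint (s : ℝ) : Plane := !₂[s, 1]

/-- The central projection of the line at height one to the upper half of the circle with
radius `R` about the origin. -/
noncomputable def circlePoint (R s : ℝ) : Plane := (R / √(1 + s ^ 2)) • linePoint s

/-- The measure `(1 + s²)^(-(3 - α) / 2) ds` on the line. -/
noncomputable def bracketMeasure (α : ℝ) : Measure ℝ :=
  volume.withDensity fun s => ENNReal.ofReal ((1 + s ^ 2) ^ (-(3 - α) / 2))

/-- The measure on the half circle of radius `R` with density proportional to
`(sin θ) ^ (1 - α)`. -/
noncomputable def halfCircleMeasure (α R : ℝ) : Measure Plane := (bracketMeasure α).map (circlePoint R)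

theorem norm_horizontal : ‖horizontal‖ = 1 := by
  simp [horizontal, EuclideanSpace.norm_eq, Fin.sum_univ_two]

theorem norm_linePoint (s : ℝ) : ‖linePoint s‖ = √(1 + s ^ 2) := by
  simp [linePoint, EuclideanSpace.norm_eq, Fin.sum_univ_two, add_comm]

theorem linePoint_ne_zero (s : ℝ) : linePoint s ≠ 0 := by
  intro h
  have := congrArg (fun u : Plane => u 1) h
  simp [linePoint] at this

theorem linePoint_eq (s : ℝ) : linePoint s = s • horizontal + linePoint 0 := by
  ext i
  fin_cases i <;> simp [linePoint, horizontal]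

theorem continuous_linePoint : Continuous linePoint := by
  have : linePoint = fun s => s • horizontal + linePoint 0 := funext linePoint_eq
  rw [this]
  fun_prop

theorem one_add_sq_pos (s : ℝ) : 0 < 1 + s ^ 2 := by positivity

theorem continuous_circlePoint (R : ℝ) : Continuous (circlePoint R) := by
  unfold circlePoint
  refine (continuous_const.div (g := fun s : ℝ => √(1 + s ^ 2)) (by fun_prop) fun s => ?_).smul
    continuous_linePoint
  exact (Real.sqrt_pos.2 (one_add_sq_pos s)).ne'

theorem norm_circlePoint {R : ℝ} (hR : 0 ≤ R) (s : ℝ) : ‖circlePoint R s‖ = R := by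
  have := Real.sqrt_pos.2 (one_add_sq_pos s)
  rw [circlePoint, norm_smul, norm_linePoint, Real.norm_of_nonneg (by positivity)]
  field_simp

theorem continuous_bracket (α : ℝ) : Continuous fun s : ℝ => (1 + s ^ 2) ^ (-(3 - α) / 2) :=
  Continuous.rpow_const (by fun_prop) fun s => Or.inl (one_add_sq_pos s).ne'

theorem integrable_bracket {α : ℝ} (hα : α < 2) :
    Integrable fun s : ℝ => (1 + s ^ 2) ^ (-(3 - α) / 2) := by
  have := integrable_rpow_neg_one_add_norm_sq (E := ℝ) (μ := volume) (r := 3 - α)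
    (by simp; linarith)
  simpa using this

theorem isFiniteMeasure_bracketMeasure {α : ℝ} (hα : α < 2) :
    IsFiniteMeasure (bracketMeasure α) := by
  refine isFiniteMeasure_withDensity ?_
  exact ((hasFiniteIntegral_iff_ofReal (ae_of_all _ fun s => by positivity)).1
    (integrable_bracket hα).2).ne

theorem bracketMeasure_ne_zero (α : ℝ) : bracketMeasure α ≠ 0 := by
  intro h
  rw [bracketMeasure, withDensity_eq_zero_iff (by
    exact (continuous_bracket α).measurable.ennreal_ofReal.aemeasurable)] at h
  obtain ⟨s, hs⟩ := h.exists
  simp only [Pi.zero_apply, ENNReal.ofReal_eq_zero] at hs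
  exact absurd hs (not_le.2 (Real.rpow_pos_of_pos (one_add_sq_pos s) _))

theorem integral_bracketMeasure (α : ℝ) (g : ℝ → ℝ) :
    ∫ s, g s ∂bracketMeasure α = ∫ s, (1 + s ^ 2) ^ (-(3 - α) / 2) * g s := by
  rw [bracketMeasure, integral_withDensity_eq_integral_toReal_smul
    (continuous_bracket α).measurable.ennreal_ofReal (by simp)]
  refine integral_congr_ae (ae_of_all _ fun s => ?_)
  simp only [smul_eq_mul]
  rw [ENNReal.toReal_ofReal (by positivity)]

/-! ### Homogeneous kernels and the vanishing horizontal derivative -/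

namespace IsHomogeneousKernel

variable {α : ℝ} {κ : Plane → ℝ}

theorem differentiableAt (h : IsHomogeneousKernel α κ) {w : Plane} (hw : w ≠ 0) :
    DifferentiableAt ℝ κ w :=
  (h.contDiffOn.differentiableOn one_ne_zero).differentiableAt
    (isOpen_compl_singleton.mem_nhds hw)

theorem continuousOn_fderiv (h : IsHomogeneousKernel α κ) (e : Plane) :
    ContinuousOn (fun w => fderiv ℝ κ w e) {0}ᶜ :=
  (h.contDiffOn.continuousOn_fderiv_of_isOpen isOpen_compl_singleton le_rfl).clm_apply
    continuousOn_const

/-- Differentiate the homogeneity relation in `w`: the chain rule yields an extra factor `c` on the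
left, which lowers the exponent by one. -/
theorem fderiv_smul (h : IsHomogeneousKernel α κ) (e : Plane) {c : ℝ} (hc : 0 < c)
    {w : Plane} (hw : w ≠ 0) : fderiv ℝ κ (c • w) e = c ^ (α - 3) * fderiv ℝ κ w e := by
  have h1 : HasFDerivAt (fun v => κ (c • v)) ((fderiv ℝ κ (c • w)).comp
      (c • ContinuousLinearMap.id ℝ Plane)) w :=
    (h.differentiableAt (smul_ne_zero hc.ne' hw)).hasFDerivAt.comp w
      ((hasFDerivAt_id w).const_smul c)
  have h2 : HasFDerivAt (fun v => κ (c • v)) (c ^ (α - 2) • fderiv ℝ κ w) w := by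
    refine ((h.differentiableAt hw).hasFDerivAt.const_smul (c ^ (α - 2))).congr_of_eventuallyEq ?_
    filter_upwards [isOpen_compl_singleton.mem_nhds hw] with v hv
    simpa using h.map_smul c hc v hv
  have h3 := congrArg (fun L : Plane →L[ℝ] ℝ => L e) (h1.unique h2)
  simp only [ContinuousLinearMap.comp_apply, smul_apply,
    ContinuousLinearMap.id_apply, _root_.map_smul, smul_eq_mul] at h3
  have h4 : c ^ (α - 2) = c * c ^ (α - 3) := by
    rw [show α - 2 = 1 + (α - 3) by ring, Real.rpow_add hc, Real.rpow_one]
  rw [h4, mul_assoc] at h3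
  exact mul_left_cancel₀ hc.ne' h3

end IsHomogeneousKernel

/-- A function that is continuous off the origin and homogeneous is bounded by a multiple of the
corresponding power of the norm. -/
theorem exists_le_norm_rpow {g : Plane → ℝ} {p : ℝ} (hg : ContinuousOn g {0}ᶜ)
    (hp : ∀ c : ℝ, 0 < c → ∀ w : Plane, w ≠ 0 → g (c • w) = c ^ p * g w) :
    ∃ C, ∀ w : Plane, w ≠ 0 → |g w| ≤ ‖w‖ ^ p * C := by
  obtain ⟨C, hC⟩ := (isCompact_sphere (0 : Plane) 1).exists_bound_of_continuousOn
    (hg.mono fun w hw => by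
      rintro rfl
      simp at hw)
  refine ⟨C, fun w hw => ?_⟩
  have hw' : 0 < ‖w‖ := norm_pos_iff.2 hw
  have h1 : w = ‖w‖ • (‖w‖⁻¹ • w) := by rw [smul_smul, mul_inv_cancel₀ hw'.ne', one_smul]
  have h2 : ‖‖w‖⁻¹ • w‖ = 1 := by
    rw [norm_smul, norm_inv, norm_norm, inv_mul_cancel₀ hw'.ne']
  have h3 := hC (‖w‖⁻¹ • w) (by simpa using h2)
  have h4 := hp ‖w‖ hw' (‖w‖⁻¹ • w) (by simpa using hw)
  rw [← h1] at h4
  rw [h4, abs_mul, abs_of_nonneg (by positivity)]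
  exact mul_le_mul_of_nonneg_left h3 (by positivity)

theorem tendsto_one_add_sq_atTop : Tendsto (fun s : ℝ => √(1 + s ^ 2)) atTop atTop :=
  tendsto_atTop_mono (fun s => Real.le_sqrt_of_sq_le (by simp)) tendsto_id

theorem tendsto_one_add_sq_atBot : Tendsto (fun s : ℝ => √(1 + s ^ 2)) atBot atTop := by
  simpa [Function.comp_def] using tendsto_one_add_sq_atTop.comp tendsto_neg_atBot_atTop

namespace IsHomogeneousKernel

variable {α : ℝ} {κ : Plane → ℝ}

theorem tendsto_linePoint (h : IsHomogeneousKernel α κ) (hα : α < 2) {l : Filter ℝ}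
    (hl : Tendsto (fun s : ℝ => √(1 + s ^ 2)) l atTop) :
    Tendsto (fun s => κ (-linePoint s)) l (𝓝 0) := by
  obtain ⟨C, hC⟩ := exists_le_norm_rpow h.contDiffOn.continuousOn h.map_smul
  refine squeeze_zero_norm (a := fun s => √(1 + s ^ 2) ^ (-(2 - α)) * C) (fun s => ?_) ?_
  · have := hC (-linePoint s) (neg_ne_zero.2 (linePoint_ne_zero s))
    rwa [norm_neg, norm_linePoint, show α - 2 = -(2 - α) by ring] at this
  · simpa using ((tendsto_rpow_neg_atTop (by linarith : 0 < 2 - α)).comp hl).mul_const C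

/-- The fundamental theorem of calculus on the line: up to sign the integrand is the derivative of
`s ↦ κ (-linePoint s)`, which tends to zero at both ends since `α < 2`. -/
theorem integral_fderiv_linePoint (h : IsHomogeneousKernel α κ) (hα : α < 2) :
    ∫ s, fderiv ℝ κ (-linePoint s) horizontal = 0 := by
  have hne : ∀ s, -linePoint s ≠ 0 := fun s => neg_ne_zero.2 (linePoint_ne_zero s)
  have hd : ∀ s, HasDerivAt (fun s => κ (-linePoint s))
      (-fderiv ℝ κ (-linePoint s) horizontal) s := by
    intro s
    have h1 : HasDerivAt (fun s => -linePoint s) (-horizontal) s := by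
      have : (fun s => -linePoint s) = fun s => -(s • horizontal + linePoint 0) := by
        funext s
        rw [← linePoint_eq]
      rw [this]
      simpa using (((hasDerivAt_id s).smul_const horizontal).add_const (linePoint 0)).fun_neg
    have h2 := (h.differentiableAt (hne s)).hasFDerivAt.comp_hasDerivAt s h1
    rwa [map_neg] at h2
  obtain ⟨C, hC⟩ := exists_le_norm_rpow (h.continuousOn_fderiv horizontal)
    fun c hc w hw => h.fderiv_smul horizontal hc hw
  -- Degree `α - 3` gives decay like `|s|^(α - 3)`, integrable since `3 - α > 1`.
  have hint : Integrable fun s => -fderiv ℝ κ (-linePoint s) horizontal := by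
    refine ((integrable_bracket hα).mul_const C).mono' ?_ (ae_of_all _ fun s => ?_)
    · exact ((h.continuousOn_fderiv horizontal).comp_continuous continuous_linePoint.neg
        hne).neg.aestronglyMeasurable
    · have := hC _ (hne s)
      rw [norm_neg, norm_linePoint, Real.sqrt_eq_rpow, ← Real.rpow_mul (by positivity)] at this
      rw [norm_neg, Real.norm_eq_abs]
      convert this using 3
      ring
  have := integral_of_hasDerivAt_of_tendsto hd hint
    (h.tendsto_linePoint hα tendsto_one_add_sq_atBot)
    (h.tendsto_linePoint hα tendsto_one_add_sq_atTop)
  rw [integral_neg] at this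
  linarith

/-- The weight cancels the factor `(1 + s²)^((3 - α)/2)` that homogeneity produces between the
circle and the line. -/
theorem integral_fderiv_circlePoint (h : IsHomogeneousKernel α κ) (hα : α < 2) {R : ℝ}
    (hR : 0 < R) :
    ∫ s, fderiv ℝ κ (-circlePoint R s) horizontal ∂bracketMeasure α = 0 := by
  rw [integral_bracketMeasure]
  have : ∀ s : ℝ, (1 + s ^ 2) ^ (-(3 - α) / 2) * fderiv ℝ κ (-circlePoint R s) horizontal
      = R ^ (α - 3) * fderiv ℝ κ (-linePoint s) horizontal := by
    intro s
    have hs := one_add_sq_pos s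
    rw [circlePoint, ← smul_neg, h.fderiv_smul _ (div_pos hR (Real.sqrt_pos.2 hs))
      (neg_ne_zero.2 (linePoint_ne_zero s)), Real.div_rpow hR.le (Real.sqrt_nonneg _),
      Real.sqrt_eq_rpow, ← Real.rpow_mul hs.le,
      show -(3 - α) / 2 = 1 / 2 * (α - 3) by ring]
    have := (Real.rpow_pos_of_pos hs (1 / 2 * (α - 3))).ne'
    field_simp
  simp_rw [this]
  rw [integral_const_mul, h.integral_fderiv_linePoint hα, mul_zero]

/-- The derivative at the centre, in the direction of the axis, of the convolution of a
homogeneous kernel with the measure on the half circle vanishes. -/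
theorem hasDerivAt_integral_circlePoint (h : IsHomogeneousKernel α κ) (hα : α < 2) {R : ℝ}
    (hR : 0 < R) :
    HasDerivAt (fun t : ℝ => ∫ s, κ (t • horizontal - circlePoint R s) ∂bracketMeasure α) 0 0 := by
  have := isFiniteMeasure_bracketMeasure hα
  -- For `|t| < R/2` the arguments stay in a compact annulus away from the origin, so constants
  -- dominate the kernel and its derivative.
  have hnorm : ∀ t ∈ Metric.ball (0 : ℝ) (R / 2), ∀ s,
      t • horizontal - circlePoint R s ∈ Metric.closedBall (0 : Plane) (2 * R) \
        Metric.ball 0 (R / 2) := by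
    intro t ht s
    have ht' : ‖t • horizontal‖ < R / 2 := by
      rw [norm_smul, norm_horizontal, mul_one]
      simpa using ht
    have h1 := norm_circlePoint hR.le s
    have h2 := norm_sub_le (t • horizontal) (circlePoint R s)
    have h3 := norm_sub_norm_le (circlePoint R s) (t • horizontal)
    rw [norm_sub_rev] at h3
    simp only [Set.mem_sdiff, mem_closedBall_zero_iff, mem_ball_zero_iff, not_lt]
    constructor <;> linarith
  have hK : IsCompact (Metric.closedBall (0 : Plane) (2 * R) \ Metric.ball 0 (R / 2)) :=
    (isCompact_closedBall _ _).diff Metric.isOpen_ball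
  have hsub : Metric.closedBall (0 : Plane) (2 * R) \ Metric.ball 0 (R / 2) ⊆ {0}ᶜ := by
    rintro w hw rfl
    exact hw.2 (Metric.mem_ball_self (by positivity))
  have hcont : ∀ t : ℝ, Continuous fun s => t • horizontal - circlePoint R s := fun t =>
    continuous_const.sub (continuous_circlePoint R)
  have hball : Metric.ball (0 : ℝ) (R / 2) ∈ 𝓝 0 := Metric.ball_mem_nhds _ (by positivity)
  have h0 : (0 : ℝ) ∈ Metric.ball (0 : ℝ) (R / 2) := Metric.mem_ball_self (by positivity)
  obtain ⟨C₁, hC₁⟩ := hK.exists_bound_of_continuousOn (h.contDiffOn.continuousOn.mono hsub)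
  obtain ⟨C₂, hC₂⟩ := hK.exists_bound_of_continuousOn ((h.continuousOn_fderiv horizontal).mono hsub)
  have hmeas : ∀ t ∈ Metric.ball (0 : ℝ) (R / 2), AEStronglyMeasurable
      (fun s => κ (t • horizontal - circlePoint R s)) (bracketMeasure α) := fun t ht =>
    (h.contDiffOn.continuousOn.comp_continuous (hcont t)
      fun s => hsub (hnorm t ht s)).aestronglyMeasurable
  have key := hasDerivAt_integral_of_dominated_loc_of_deriv_le
    (μ := bracketMeasure α) (F := fun t s => κ (t • horizontal - circlePoint R s))
    (F' := fun t s => fderiv ℝ κ (t • horizontal - circlePoint R s) horizontal)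
    (bound := fun _ => C₂) (x₀ := 0) hball
    (eventually_of_mem hball hmeas)
    ((integrable_const C₁).mono' (hmeas 0 h0)
      (ae_of_all _ fun s => hC₁ _ (hnorm 0 h0 s)))
    ((h.continuousOn_fderiv horizontal).comp_continuous (hcont 0)
      fun s => hsub (hnorm 0 h0 s)).aestronglyMeasurable
    (ae_of_all _ fun s t ht => hC₂ _ (hnorm t ht s))
    (integrable_const C₂)
    (ae_of_all _ fun s t ht => by
      have h1 : HasDerivAt (fun t : ℝ => t • horizontal - circlePoint R s) horizontal t := by
        simpa using ((hasDerivAt_id t).smul_const horizontal).sub_const (circlePoint R s)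
      exact (h.differentiableAt (hsub (hnorm t ht s))).hasFDerivAt.comp_hasDerivAt t h1)
  have h2 := key.2
  simp only [zero_smul, zero_sub] at h2
  rwa [h.integral_fderiv_circlePoint hα hR] at h2

end IsHomogeneousKernel

/-! ### Transplanting kernels and measures to a square -/

theorem contDiffOn_convKernel {α : ℝ} {Ω : Plane → ℝ}
    (hΩ : ContDiffOn ℝ 1 (fun w => Ω (‖w‖⁻¹ • w)) {0}ᶜ) :
    ContDiffOn ℝ 1 (convKernel α Ω) {0}ᶜ := by
  intro w hw
  have hw' : w ≠ 0 := hw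
  have h1 : ContDiffWithinAt ℝ 1 (fun w : Plane => ‖w‖ ^ (2 - α)) {0}ᶜ w :=
    ((contDiffAt_norm ℝ hw').rpow_const_of_ne (norm_ne_zero_iff.2 hw')).contDiffWithinAt
  exact (hΩ w hw).div h1 (Real.rpow_pos_of_pos (norm_pos_iff.2 hw') _).ne'

theorem convKernel_smul (α : ℝ) (Ω : Plane → ℝ) {c : ℝ} (hc : 0 < c) (w : Plane) :
    convKernel α Ω (c • w) = c ^ (α - 2) * convKernel α Ω w := by
  have h1 : ‖c • w‖⁻¹ • c • w = ‖w‖⁻¹ • w := by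
    rw [norm_smul, Real.norm_of_nonneg hc.le, smul_smul, mul_inv, mul_comm c⁻¹, mul_assoc,
      inv_mul_cancel₀ hc.ne', mul_one]
  rw [convKernel, convKernel, h1, norm_smul, Real.norm_of_nonneg hc.le,
    Real.mul_rpow hc.le (norm_nonneg w), show α - 2 = -(2 - α) by ring, Real.rpow_neg hc.le]
  rw [div_eq_mul_inv, mul_inv, div_eq_mul_inv]
  ring

/-- The similarity onto `J` is absorbed into the kernel: the class of homogeneous kernels is stable
under rotation, reflection and scaling, so all squares reduce to the unit square. -/
theorem isHomogeneousKernel_convKernel {α : ℝ} {Ω : Plane → ℝ}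
    (hΩ : ContDiffOn ℝ 1 (fun w => Ω (‖w‖⁻¹ • w)) {0}ᶜ) {σ : ℝ} (hσ : 0 < σ)
    (F : Plane ≃ₗᵢ[ℝ] Plane) :
    IsHomogeneousKernel α fun w => convKernel α Ω (σ • F w) where
  contDiffOn := by
    refine (contDiffOn_convKernel hΩ).comp
      (F.contDiff.const_smul σ).contDiffOn fun w hw => ?_
    simpa [hσ.ne'] using hw
  map_smul c hc w hw := by
    rw [_root_.map_smul, smul_comm, convKernel_smul α Ω hc]

theorem PlaneSquare.place_sub (J : PlaneSquare) (u v : Plane) :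
    J.place u - J.place v = J.side • J.frame (u - v) := by
  simp [PlaneSquare.place, smul_sub]

theorem PlaneSquare.norm_place_sub (J : PlaneSquare) (u v : Plane) :
    ‖J.place u - J.place v‖ = J.side * ‖u - v‖ := by
  rw [J.place_sub, norm_smul, J.frame.norm_map, Real.norm_of_nonneg J.side_pos.le]

theorem PlaneSquare.place_zero (J : PlaneSquare) : J.place 0 = J.center := by
  simp [PlaneSquare.place]

theorem transplant_halfCircleMeasure (J : PlaneSquare) (α R : ℝ) :
    J.transplant (halfCircleMeasure α R) =
      (bracketMeasure α).map fun s => J.place (circlePoint R s) :=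
  Measure.map_map J.measurable_place (continuous_circlePoint R).measurable

theorem integral_transplant_halfCircleMeasure (J : PlaneSquare) (α R : ℝ) {g : Plane → ℝ}
    (hg : Measurable g) :
    ∫ y, g y ∂J.transplant (halfCircleMeasure α R) =
      ∫ s, g (J.place (circlePoint R s)) ∂bracketMeasure α := by
  rw [transplant_halfCircleMeasure]
  exact integral_map_of_stronglyMeasurable
    (J.measurable_place.comp (continuous_circlePoint R).measurable) hg.stronglyMeasurable

theorem vecTransform_place {ι : Type} [Fintype ι] {α : ℝ} {Ω : ι → Plane → ℝ}
    (hΩ : ∀ i, ContDiffOn ℝ 1 (fun w => Ω i (‖w‖⁻¹ • w)) {0}ᶜ) (J : PlaneSquare) (R : ℝ)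
    (u : Plane) (i : ι) :
    vecTransform α Ω (J.transplant (halfCircleMeasure α R)) (J.place u) i =
      ∫ s, convKernel α (Ω i) (J.side • J.frame (u - circlePoint R s)) ∂bracketMeasure α := by
  have hm : Measurable (convKernel α (Ω i)) :=
    measurable_of_continuousOn_compl_singleton 0 (contDiffOn_convKernel (hΩ i)).continuousOn
  simp_rw [← J.place_sub]
  exact integral_transplant_halfCircleMeasure J α R (hm.comp (measurable_const.sub measurable_id))

theorem poisson_transplant_pos {α : ℝ} (hα : α < 2) (J : PlaneSquare) {R : ℝ} (hR : 0 < R) :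
    0 < poisson α J (J.transplant (halfCircleMeasure α R)) := by
  have := isFiniteMeasure_bracketMeasure hα
  have hσ := J.side_pos
  rw [poisson, integral_transplant_halfCircleMeasure J α R (by fun_prop)]
  simp_rw [← J.place_zero, J.norm_place_sub, sub_zero, norm_circlePoint hR.le]
  rw [integral_const, smul_eq_mul]
  refine mul_pos ?_ (by positivity)
  rw [measureReal_def, ENNReal.toReal_pos_iff]
  exact ⟨by simpa [pos_iff_ne_zero] using bracketMeasure_ne_zero α, measure_lt_top _ _⟩

/-- The measure lives on the circle of radius `R` times the side, whereas the dilate has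
circumradius only `R/√2` times the side. -/
theorem support_transplant_subset {α : ℝ} (J : PlaneSquare) {R : ℝ} (hR : 0 < R) :
    (J.transplant (halfCircleMeasure α R)).support ⊆ (J.dilate R)ᶜ := by
  have hcl : IsClosed {y : Plane | ‖y - J.center‖ = J.side * R} :=
    isClosed_eq (by fun_prop) continuous_const
  have hsub := Measure.support_subset_of_isClosed (μ := J.transplant (halfCircleMeasure α R)) hcl
    (by
      have hm : Measurable fun s => J.place (circlePoint R s) :=
        J.measurable_place.comp (continuous_circlePoint R).measurable
      rw [transplant_halfCircleMeasure, mem_ae_map_iff hm.aemeasurable hcl.measurableSet]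
      filter_upwards with s
      simp only [mem_preimage, mem_ofPred_eq, ← J.place_zero, J.norm_place_sub, sub_zero,
        norm_circlePoint hR.le])
  refine hsub.trans ?_
  rintro _ hy ⟨u, hu, rfl⟩
  rw [mem_ofPred_eq, ← J.place_zero, J.norm_place_sub, sub_zero] at hy
  have hy' := mul_left_cancel₀ J.side_pos.ne' hy
  have h1 : ‖u‖ ^ 2 = u 0 ^ 2 + u 1 ^ 2 := by
    simp [EuclideanSpace.norm_sq_eq, Fin.sum_univ_two]
  have h2 : ∀ i, u i ^ 2 ≤ (R / 2) ^ 2 := fun i =>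
    sq_le_sq' (abs_le.1 (hu i)).1 (abs_le.1 (hu i)).2
  have h3 := h2 0
  have h4 := h2 1
  rw [hy'] at h1
  nlinarith

/-! ### Two point masses and the failure of reversal -/

theorem setAverage_dirac_add_dirac {s : Set Plane} {p q : Plane} (hp : p ∈ s) (hq : q ∈ s)
    (f : Plane → ℝ) :
    ⨍ x in s, f x ∂(Measure.dirac p + Measure.dirac q) = (f p + f q) / 2 := by
  have h : (Measure.dirac p + Measure.dirac q).restrict s = Measure.dirac p + Measure.dirac q := by
    rw [Measure.restrict_eq_self_of_ae_mem]
    rw [ae_add_measure_iff, ae_dirac_eq, ae_dirac_eq]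
    exact ⟨hp, hq⟩
  rw [h, average_eq, integral_add_measure (integrable_dirac (by simp)) (integrable_dirac (by simp)),
    integral_dirac, integral_dirac]
  simp only [measureReal_def, Measure.coe_add, Pi.add_apply, measure_univ, one_add_one_eq_two,
    ENNReal.toReal_ofNat, smul_eq_mul]
  ring

/-- A family of functions whose derivatives at the origin vanish has arbitrarily small increments
relative to the displacement. -/
theorem exists_sum_sq_lt {ι : Type*} [Fintype ι] {f : ι → ℝ → ℝ}
    (hf : ∀ i, HasDerivAt (f i) 0 0) {ε : ℝ} (hε : 0 < ε) (C : ℝ) :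
    ∃ t : ℝ, 0 < t ∧ t ≤ 1 / 2 ∧ C * ∑ i, (f i t - f i 0) ^ 2 < ε * t ^ 2 := by
  have h1 : Tendsto (fun t => C * ∑ i, (t⁻¹ * (f i t - f i 0)) ^ 2) (𝓝[>] 0) (𝓝 0) := by
    have : ∀ i, Tendsto (fun t => t⁻¹ * (f i t - f i 0)) (𝓝[>] 0) (𝓝 0) := fun i => by
      simpa using (hf i).tendsto_slope_zero_right
    simpa using (tendsto_finsetSum Finset.univ fun i _ => (this i).pow 2).const_mul C
  have h2 : ∀ᶠ t : ℝ in 𝓝[>] 0, t ∈ Ioc (0 : ℝ) (1 / 2) := Ioc_mem_nhdsGT (by norm_num)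
  obtain ⟨t, ht, ht'⟩ := ((h1.eventually_lt_const hε).and h2).exists
  refine ⟨t, ht'.1, ht'.2, ?_⟩
  have ht0 := ht'.1
  simp_rw [mul_pow, ← Finset.mul_sum] at ht
  calc _ = (C * (t⁻¹ ^ 2 * ∑ i, (f i t - f i 0) ^ 2)) * t ^ 2 := by field_simp
    _ < ε * t ^ 2 := by gcongr

theorem reversalFails_halfCircleMeasure {ι : Type} [Fintype ι] {α : ℝ} (hα : α < 2)
    {Ω : ι → Plane → ℝ} (hΩ : ∀ i, ContDiffOn ℝ 1 (fun w => Ω i (‖w‖⁻¹ • w)) {0}ᶜ)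
    (C₀ : ℝ) (J : PlaneSquare) {R : ℝ} (hR : 0 < R) :
    ReversalFails α Ω C₀ J (J.transplant (halfCircleMeasure α R)) := by
  set μ := J.transplant (halfCircleMeasure α R) with hμ
  have hP : 0 < poisson α J μ := poisson_transplant_pos hα J hR
  -- Here `ε` is the squared Poisson integral, which does not depend on `t`; the bound `t ≤ 1/2`
  -- keeps the second mass inside `J`.
  obtain ⟨t, ht0, ht1, ht⟩ := exists_sum_sq_lt
    (fun i => (isHomogeneousKernel_convKernel (hΩ i) J.side_pos
      J.frame).hasDerivAt_integral_circlePoint hα hR) (pow_pos hP 2) C₀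
  simp_rw [← vecTransform_place hΩ J R, ← hμ] at ht
  rw [zero_smul] at ht
  set p := J.place 0
  set q := J.place (t • horizontal)
  have hp : p ∈ J.carrier := ⟨0, fun i => by simp, rfl⟩
  have hq : q ∈ J.carrier := by
    refine ⟨_, fun i => ?_, rfl⟩
    fin_cases i
    · simpa [horizontal, abs_of_pos ht0] using ht1
    · simp [horizontal]
  have hpq : ‖q - p‖ / J.side = t := by
    have := J.side_pos
    rw [J.norm_place_sub, sub_zero, norm_smul, norm_horizontal, Real.norm_of_nonneg ht0.le]
    field_simp
  have hV : ‖vecTransform α Ω μ q - vecTransform α Ω μ p‖ ^ 2 =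
      ∑ i, (vecTransform α Ω μ q i - vecTransform α Ω μ p i) ^ 2 := by
    simp [EuclideanSpace.norm_sq_eq]
  -- Of the four ordered pairs of masses, the two off-diagonal ones contribute. The same factor
  -- `1/2` appears on the right side of the inequality and drops out.
  have hE : energy J (Measure.dirac p + Measure.dirac q) ^ 2 = t ^ 2 / 2 := by
    rw [energy]
    simp_rw [setAverage_dirac_add_dirac hp hq]
    rw [norm_sub_rev p q, hpq, Real.sq_sqrt (by simp; positivity)]
    simp only [sub_self, norm_zero, zero_div]
    ring
  refine ⟨Measure.dirac p + Measure.dirac q, inferInstance, ?_, ?_⟩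
  · simp [hp]
  · rw [StrongReversal, hE]
    simp_rw [setAverage_dirac_add_dirac hp hq]
    rw [norm_sub_rev (vecTransform α Ω μ p) (vecTransform α Ω μ q), hV, not_le]
    simp only [sub_self, norm_zero]
    linarith

/-! ### Smoothness of the Riesz and trigonometric angular parts -/

theorem contDiffOn_inv_norm_smul :
    ContDiffOn ℝ 1 (fun w : Plane => ‖w‖⁻¹ • w) {0}ᶜ := by
  intro w hw
  have hw' : w ≠ 0 := hw
  exact (((contDiffAt_norm ℝ hw').inv (norm_ne_zero_iff.2 hw')).smul
    contDiffAt_id).contDiffWithinAt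

theorem contDiffOn_rieszAngular (l : Fin 2) :
    ContDiffOn ℝ 1 (fun w => rieszAngular l (‖w‖⁻¹ • w)) {0}ᶜ :=
  (EuclideanSpace.proj l : Plane →L[ℝ] ℝ).contDiff.comp_contDiffOn
    contDiffOn_inv_norm_smul

/-- On the unit circle, `e^{ikθ}` is the `k`-th power of the point as a complex number. -/
theorem exp_mul_angle {u : Plane} (hu : ‖u‖ = 1) (k : ℕ) :
    Complex.exp (((k : ℝ) * angle u : ℝ) * Complex.I) = ((u 0 : ℂ) + u 1 * Complex.I) ^ k := by
  have h1 : ‖(⟨u 0, u 1⟩ : ℂ)‖ = 1 := by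
    rw [← hu, Complex.norm_def, EuclideanSpace.norm_eq, Fin.sum_univ_two]
    simp [Complex.normSq_apply, sq]
  have h2 := Complex.norm_mul_exp_arg_mul_I ⟨u 0, u 1⟩
  rw [h1, Complex.ofReal_one, one_mul] at h2
  rw [← Complex.mk_eq_add_mul_I, angle]
  conv_rhs => rw [← h2, ← Complex.exp_nat_mul]
  congr 1
  push_cast
  ring

/-- The angle jumps across the negative axis, but for integer `k` the exponential is a polynomial in
the coordinates of the normalized point, so the jump disappears. -/
theorem contDiffOn_exp_mul_angle (k : ℕ) :
    ContDiffOn ℝ 1 (fun w : Plane =>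
      Complex.exp (((k : ℝ) * angle (‖w‖⁻¹ • w) : ℝ) * Complex.I)) {0}ᶜ := by
  have h1 : ∀ l : Fin 2, ContDiffOn ℝ 1 (fun w : Plane => (((‖w‖⁻¹ • w) l : ℝ) : ℂ)) {0}ᶜ :=
    fun l => Complex.ofRealCLM.contDiff.comp_contDiffOn (contDiffOn_rieszAngular l)
  refine (((h1 0).add ((h1 1).mul (contDiffOn_const (c := Complex.I)))).pow k).congr fun w hw => ?_
  refine exp_mul_angle ?_ k
  rw [norm_smul, norm_inv, norm_norm, inv_mul_cancel₀ (norm_ne_zero_iff.2 hw)]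

theorem contDiffOn_trigAngular (M : ℕ) (i : Fin M ⊕ Fin M) :
    ContDiffOn ℝ 1 (fun w => trigAngular M i (‖w‖⁻¹ • w)) {0}ᶜ := by
  rcases i with j | j
  · refine (Complex.reCLM.contDiff.comp_contDiffOn (contDiffOn_exp_mul_angle (j + 1))).congr
      fun w _ => ?_
    exact (Complex.exp_ofReal_mul_I_re _).symm
  · refine (Complex.imCLM.contDiff.comp_contDiffOn (contDiffOn_exp_mul_angle (j + 1))).congr
      fun w _ => ?_
    exact (Complex.exp_ofReal_mul_I_im _).symm

theorem lemma2 (α : ℝ) (hα0 : 0 ≤ α) (hα2 : α < 2) :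
    ∃ ν : ℝ → Measure Plane,
      (∀ γ : ℝ, IsFiniteMeasure (ν γ)) ∧
      ∀ C₀ : ℝ, 0 < C₀ → ∃ γ₀ : ℝ, 2 < γ₀ ∧ ∀ γ : ℝ, γ₀ ≤ γ → ∀ J : PlaneSquare,
        (J.transplant (ν γ)).support ⊆ (J.dilate γ)ᶜ ∧
        ReversalFails α rieszAngular C₀ J (J.transplant (ν γ)) ∧
        ∀ M : ℕ, 1 ≤ M → ReversalFails α (trigAngular M) C₀ J (J.transplant (ν γ)) := by
  -- The radius is `γ` itself. The threshold `3` is arbitrary: the argument works for every `γ > 0`,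
  -- and `C₀` affects only the distance between the masses of `ω`.
  refine ⟨halfCircleMeasure α, fun γ => ?_, fun C₀ _ => ⟨3, by norm_num, fun γ hγ J => ?_⟩⟩
  · have := isFiniteMeasure_bracketMeasure hα2
    exact Measure.isFiniteMeasure_map _ _
  · have hγ' : 0 < γ := by linarith
    exact ⟨support_transplant_subset J hγ',
      reversalFails_halfCircleMeasure hα2 contDiffOn_rieszAngular C₀ J hγ',
      fun M _ => reversalFails_halfCircleMeasure hα2 (contDiffOn_trigAngular M) C₀ J hγ'⟩
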